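/- \textbf{Model.} A market consists of finite sets $B$ of buyers, $S$ of stores and $D$ of couriers, valuations $v_b(s)\ge 0$ and delivery costs $c_d(b,s)\ge 0$ (real numbers). An \emph{allocation} is $x=(x_{bsd})$ with $x_{bsd}\in\{0,1\}$; it is \emph{feasible} if $\sum_{s,d}x_{bsd}\le 1$ for every $b$, $\sum_{b,d}x_{bsd}\le 1$ for every $s$, and $\sum_{b,s}x_{bsd}\le 1$ for every $d$. Its welfare is $W(x)=\sum_{b,s,d}x_{bsd}\,(v_b(s)-c_d(b,s))$, and $\mathrm{OPT}=\max\{W(x): x \text{ feasible}\}$. In a feasible $x$, buyer $b$ buys from a store $s_x(b)$ or from none ($s_x(b)=\emptyset$), and courier $d$ delivers an order $o_x(d)\in B\times S$ or none ($o_x(d)=\emptyset$). For a utility function $u$ on a set of options, let $\mathrm{BR}(u)$ be the set of maximizers of $u$ if $u$ takes a positive value, and $\{\emptyset\}\cup\{a: u(a)=0\}$ otherwise. A \emph{without-tip equilibrium} $(p,w,x)$ consists of prices $p_s\ge 0$, compensations $w_{bs}\ge 0$ and a feasible allocation $x$ such that $s_x(b)\in\mathrm{BR}\big(s\mapsto v_b(s)-p_s\big)$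 for every $b$; $o_x(d)\in\mathrm{BR}\big((b,s)\mapsto w_{bs}-c_d(b,s)\big)$ for every $d$; $p_s=0$ for every store $s$ that is not bought from; and $w_{bs}=0$ for every order $(b,s)$ that is not delivered. With tips $t_{bs}\ge 0$, let $\mathrm{BR}_d(w,t)=\mathrm{BR}\big((b,s)\mapsto w_{bs}-c_d(b,s)+t_{bs}\big)$. The minimum tip $\underline t_{bs}$ is the least value of $t'_{bs}$ over all tip vectors $t'\ge 0$ that agree with $t$ for all buyers other than $b$ and satisfy $(b,s)\in\mathrm{BR}_d(w,t')$ for some courier $d$ (it is $+\infty$ if there are no couriers). A \emph{with-tip equilibrium} $(p,w,t,x)$ consists of $p,w,t\ge 0$ and a feasible allocation $x$ such that $s_x(b)\in\mathrm{BR}\big(s\mapsto v_b(s)-p_s-\underline t_{bs}\big)$ for every $b$; $t_{bs}=\underline t_{bs}$ whenever $s=s_x(b)$ is a store; $o_x(d)\in\mathrm{BR}_d(w,t)$ for every $d$; $p_s=0$ for every store that is not bought from; and $w_{bs}=t_{bs}=0$ for every order that is not delivered. \textbf{Theorem.} (1) Suppose that the costs decompose as $c_d(b,s)=c(b,s)+e_d(s)$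 for all $d,b,s$, or as $c_d(b,s)=c(b,s)+e_d(b)$ for all $d,b,s$, with real-valued functions $c$ and $e_d$. Then there is a with-tip equilibrium $(p,w,t,x)$ with $W(x)=\mathrm{OPT}$. (2) In contrast, for every $K\in\mathbb R$ there is a market whose costs decompose in both of these ways, whose optimal welfare is $1$, which has a without-tip equilibrium, and in which every without-tip equilibrium $(p,w,x)$ has $W(x)<K$. -/

import Mathlib

/-- A market with buyers `B`, stores `S` and couriers `D`: nonnegative valuations `v b s` and
nonnegative (finite) delivery costs `c d b s`. Store costs are normalized to zero. -/
structure Market (B S D : Type*) where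
  v : B → S → ℝ
  c : D → B → S → ℝ
  v_nonneg : ∀ b s, 0 ≤ v b s
  c_nonneg : ∀ d b s, 0 ≤ c d b s

/-- The best responses of an agent with utilities `u` over the options `α`, where `none` is the null
option of utility zero: the maximizers of `u` if some option has positive utility; otherwise the
null option together with all the options of utility zero. -/
def bestResponse {α R : Type*} [Zero R] [Preorder R] (u : α → R) : Set (Option α) :=
  {o | ((∃ a, 0 < u a) ∧ ∃ a, o = some a ∧ ∀ a', u a' ≤ u a) ∨
    ((¬ ∃ a, 0 < u a) ∧ (o = none ∨ ∃ a, o = some a ∧ u a = 0))}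

/-- A feasible allocation: unit demand, unit supply and unit capacity.
The bounds force every entry to be `0` or `1`. -/
structure IsFeasible {B S D : Type*} [Fintype B] [Fintype S] [Fintype D]
    (x : B → S → D → ℕ) : Prop where
  demand : ∀ b, ∑ s, ∑ d, x b s d ≤ 1
  supply : ∀ s, ∑ b, ∑ d, x b s d ≤ 1
  capacity : ∀ d, ∑ b, ∑ s, x b s d ≤ 1

/-- `IsStoreOf x b o` says that `o` is the store that `b` buys from in `x` (`none` if there is none). -/
def IsStoreOf {B S D : Type*} (x : B → S → D → ℕ) (b : B) : Option S → Prop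
  | some s => ∃ d, x b s d = 1
  | none => ∀ s d, x b s d = 0

/-- `IsOrderOf x d o` says that `o` is the order that `d` delivers in `x` (`none` if there is none). -/
def IsOrderOf {B S D : Type*} (x : B → S → D → ℕ) (d : D) : Option (B × S) → Prop
  | some (b, s) => x b s d = 1
  | none => ∀ b s, x b s d = 0

namespace Market

/-- Costs with a buyer-store part and a courier-store part: `c_d(b,s) = c(b,s) + c_d(s)`. -/
def HasStoreDecomposition {B S D : Type*} (M : Market B S D) : Prop :=
  ∃ (c : B → S → ℝ) (e : D → S → ℝ), ∀ d b s, M.c d b s = c b s + e d s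

/-- Costs with a buyer-store part and a courier-buyer part: `c_d(b,s) = c(b,s) + c_d(b)`. -/
def HasBuyerDecomposition {B S D : Type*} (M : Market B S D) : Prop :=
  ∃ (c : B → S → ℝ) (e : D → B → ℝ), ∀ d b s, M.c d b s = c b s + e d b

/-- The welfare of an allocation. -/
def welfare {B S D : Type*} [Fintype B] [Fintype S] [Fintype D]
    (M : Market B S D) (x : B → S → D → ℕ) : ℝ :=
  ∑ b, ∑ s, ∑ d, (x b s d : ℝ) * (M.v b s - M.c d b s)

/-- `W` is the optimal welfare, the maximum of the welfare over all feasible allocations. -/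
def IsOptimalWelfare {B S D : Type*} [Fintype B] [Fintype S] [Fintype D]
    (M : Market B S D) (W : ℝ) : Prop :=
  IsGreatest {r | ∃ x : B → S → D → ℕ, IsFeasible x ∧ M.welfare x = r} W

/-- The best responses of courier `d` at compensations `w` and tips `t`. -/
def courierBR {B S D : Type*} (M : Market B S D) (w t : B → S → ℝ) (d : D) :
    Set (Option (B × S)) :=
  bestResponse fun o : B × S => w o.1 o.2 - M.c d o.1 o.2 + t o.1 o.2

/-- Without-tip equilibrium: prices `p`, compensations `w`, allocation `x`. -/
structure IsWithoutTipEquilibrium {B S D : Type*} [Fintype B] [Fintype S] [Fintype D]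
    (M : Market B S D) (p : S → ℝ) (w : B → S → ℝ) (x : B → S → D → ℕ) : Prop where
  price_nonneg : ∀ s, 0 ≤ p s
  comp_nonneg : ∀ b s, 0 ≤ w b s
  feasible : IsFeasible x
  buyer : ∀ b o, IsStoreOf x b o → o ∈ bestResponse fun s => M.v b s - p s
  courier : ∀ d o, IsOrderOf x d o →
    o ∈ bestResponse fun a : B × S => w a.1 a.2 - M.c d a.1 a.2
  unsold : ∀ s, ∑ b, ∑ d, x b s d = 0 → p s = 0
  undelivered : ∀ b s, ∑ d, x b s d = 0 → w b s = 0

/-- The minimum tip that gets some courier to deliver from `s` to `b`: the least `t' b s`, over the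
nonnegative tip profiles `t'` that agree with `t` for all the buyers other than `b`, such that `(b, s)`
is a best response of some courier. It is `⊤` exactly when there is no courier; otherwise
the minimum is attained and it is a nonnegative real number. -/
noncomputable def minTip {B S D : Type*} (M : Market B S D) (w t : B → S → ℝ) (b : B) (s : S) :
    EReal :=
  sInf {r : EReal | ∃ t' : B → S → ℝ, (∀ b' s', 0 ≤ t' b' s') ∧ (∀ b', b' ≠ b → t' b' = t b') ∧
    (∃ d, some (b, s) ∈ M.courierBR w t' d) ∧ r = (t' b s : EReal)}

/-- The best responses of buyer `b` when buying from `s` requires the minimum tip. Only the tips of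
the other buyers matter here. -/
noncomputable def buyerBR {B S D : Type*} (M : Market B S D) (p : S → ℝ) (w t : B → S → ℝ) (b : B) :
    Set (Option S) :=
  bestResponse fun s => ((M.v b s - p s : ℝ) : EReal) - M.minTip w t b s

/-- With-tip equilibrium: prices `p`, compensations `w`, tips `t`, allocation `x`. -/
structure IsWithTipEquilibrium {B S D : Type*} [Fintype B] [Fintype S] [Fintype D]
    (M : Market B S D) (p : S → ℝ) (w t : B → S → ℝ) (x : B → S → D → ℕ) : Prop where
  price_nonneg : ∀ s, 0 ≤ p s
  comp_nonneg : ∀ b s, 0 ≤ w b s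
  tip_nonneg : ∀ b s, 0 ≤ t b s
  feasible : IsFeasible x
  buyer : ∀ b o, IsStoreOf x b o → o ∈ M.buyerBR p w t b
  pays_min_tip : ∀ b s, IsStoreOf x b (some s) → (t b s : EReal) = M.minTip w t b s
  courier : ∀ d o, IsOrderOf x d o → o ∈ M.courierBR w t d
  unsold : ∀ s, ∑ b, ∑ d, x b s d = 0 → p s = 0
  undelivered : ∀ b s, ∑ d, x b s d = 0 → w b s = 0 ∧ t b s = 0

end Market

/-! Part (1) is linear programming duality. If the costs split into a buyer-store and a
store-courier part, an allocation routes units from buyers through stores of capacity one to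
couriers. This is a bipartite assignment problem (`RouteEdge`), so an integral optimum exists
together with dual values α, β, γ of buyers, stores and couriers satisfying complementary slackness
(`exists_isDualPair`). A courier-buyer part reduces to this case by exchanging buyers and stores.
Assignment duality comes from a dual of least total weight: Hall's condition holds for its tight
pairs, since a violating set would allow a cheaper dual.

A dual pair becomes an equilibrium with all tips zero: an order delivered by `d` is compensated by
γ_d plus its cost, and its store charges β_s plus that compensation. An undelivered order has
compensation zero, so a buyer who wants it must tip some courier `d` at least γ_d plus the cost.
Dual feasibility then caps the buyer's utility at α_b.

For part (2), without tips a buyer ignores delivery costs, and an unsold store must have price zero.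
A store of value 2 thus always beats one of value 1, however costly its delivery. -/

/-! ### Duality for the assignment problem -/

theorem exists_pos_le_of_finite {ι : Type*} [Finite ι] (f : ι → ℝ) :
    ∃ ε > 0, ∀ i, 0 < f i → ε ≤ f i := by
  classical
  cases nonempty_fintype ι
  rcases ({i | 0 < f i} : Finset ι).eq_empty_or_nonempty with h | h
  · refine ⟨1, one_pos, fun i hi => ?_⟩
    have : i ∈ ({i | 0 < f i} : Finset ι) := by simpa using hi
    simp [h] at this
  · obtain ⟨i, hi, hmin⟩ := Finset.exists_min_image _ f h
    exact ⟨f i, by simpa using hi, fun j hj => hmin j (by simpa using hj)⟩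

/-- A nonnegative assignment problem has a dual solution of least total weight. -/
theorem exists_min_dual {L R : Type*} [Fintype L] [Fintype R] [Nonempty L] (e : L ≃ R)
    (A : L → R → ℝ) (hA : ∀ i j, 0 ≤ A i j) :
    ∃ (u : L → ℝ) (v : R → ℝ), (∀ i j, A i j ≤ u i + v j) ∧
      ∀ (u' : L → ℝ) (v' : R → ℝ), (∀ i j, A i j ≤ u' i + v' j) →
        ∑ i, u i + ∑ j, v j ≤ ∑ i, u' i + ∑ j, v' j := by
  classical
  set a : L → ℝ := fun i => ∑ j, A i j with ha
  have ha0 : ∀ i, 0 ≤ a i := fun i => Finset.sum_nonneg fun j _ => hA i j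
  set V : ℝ := ∑ i, a i with hV
  have hV0 : 0 ≤ V := Finset.sum_nonneg fun i _ => ha0 i
  let Q : Set ((L → ℝ) × (R → ℝ)) :=
    Set.Icc 0 (fun _ => V, fun _ => V) ∩ {q | ∀ i j, A i j ≤ q.1 i + q.2 j}
  have hQc : IsCompact Q := by
    refine isCompact_Icc.inter_right ?_
    simp only [Set.ofPred_forall]
    exact isClosed_iInter fun i => isClosed_iInter fun j =>
      isClosed_le continuous_const (by fun_prop)
  have hQn : (a, (0 : R → ℝ)) ∈ Q := by
    refine ⟨⟨⟨ha0, le_rfl⟩, ⟨fun i => ?_, fun _ => hV0⟩⟩, fun i j => ?_⟩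
    · exact Finset.single_le_sum (fun i _ => ha0 i) (Finset.mem_univ i)
    · simpa using Finset.single_le_sum (fun j _ => hA i j) (Finset.mem_univ j)
  obtain ⟨⟨u, v⟩, hq, hmin⟩ := hQc.exists_isMinOn ⟨_, hQn⟩
    (f := fun q : (L → ℝ) × (R → ℝ) => ∑ i, q.1 i + ∑ j, q.2 j) (by fun_prop)
  have hle : ∑ i, u i + ∑ j, v j ≤ V := by simpa using hmin hQn
  refine ⟨u, v, hq.2, fun u' v' h' => ?_⟩
  by_contra! hlt
  -- Moving the minimum of `u'` over to `v'` keeps the total, because both sides have equally many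
  -- elements, and makes all entries nonnegative. As the total is below `V`, the shifted dual lies
  -- in the box `Q`.
  obtain ⟨i₀, hi₀⟩ := Finite.exists_min u'
  have hsum : ∑ i, (u' i - u' i₀) + ∑ j, (v' j + u' i₀) = ∑ i, u' i + ∑ j, v' j := by
    simp [Finset.sum_sub_distrib, Finset.sum_add_distrib, Fintype.card_congr e]
  have hu0 : ∀ i, 0 ≤ u' i - u' i₀ := fun i => sub_nonneg.2 (hi₀ i)
  have hv0 : ∀ j, 0 ≤ v' j + u' i₀ := fun j => by linarith [h' i₀ j, hA i₀ j]
  have hmem : ((fun i => u' i - u' i₀, fun j => v' j + u' i₀) : (L → ℝ) × (R → ℝ)) ∈ Q := by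
    have h1 := Finset.sum_nonneg fun i (_ : i ∈ Finset.univ) => hu0 i
    have h2 := Finset.sum_nonneg fun j (_ : j ∈ Finset.univ) => hv0 j
    refine ⟨⟨⟨hu0, hv0⟩, ⟨fun i => ?_, fun j => ?_⟩⟩, fun i j => ?_⟩
    · have := Finset.single_le_sum (fun i _ => hu0 i) (Finset.mem_univ i)
      dsimp only at this ⊢
      linarith
    · have := Finset.single_le_sum (fun j _ => hv0 j) (Finset.mem_univ j)
      dsimp only at this ⊢
      linarith
    · have := h' i j
      dsimp only
      linarith
  have := hmin hmem
  simp only [Set.mem_ofPred_eq, hsum] at this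
  linarith

/-- Strong duality for the assignment problem with nonnegative weights. -/
theorem exists_assignment_dual_of_nonneg {L R : Type*} [Fintype L] [Fintype R] (e : L ≃ R)
    (A : L → R → ℝ) (hA : ∀ i j, 0 ≤ A i j) :
    ∃ (σ : L ≃ R) (u : L → ℝ) (v : R → ℝ),
      (∀ i j, A i j ≤ u i + v j) ∧ ∀ i, A i (σ i) = u i + v (σ i) := by
  classical
  rcases isEmpty_or_nonempty L with hL | hL
  · exact ⟨e, 0, 0, fun i => hL.elim i, fun i => hL.elim i⟩
  obtain ⟨u, v, huv, hmin⟩ := exists_min_dual e A hA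
  let N : L → Finset R := fun i => {j | A i j = u i + v j}
  have hall : ∀ T : Finset L, T.card ≤ (T.biUnion N).card := by
    intro T
    by_contra! hT
    -- Lowering `u` on a Hall violator `T` and raising `v` on its tight neighbours, both by the
    -- least positive slack `ε`, stays feasible and reduces the total.
    obtain ⟨ε, hε, hgap⟩ := exists_pos_le_of_finite fun q : L × R => u q.1 + v q.2 - A q.1 q.2
    have := hmin (fun i => u i - if i ∈ T then ε else 0)
      (fun j => v j + if j ∈ T.biUnion N then ε else 0) fun i j => by
        have h0 := huv i j
        by_cases hi : i ∈ T <;> by_cases hj : j ∈ T.biUnion N <;> simp only [hi, hj, if_true, if_false]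
        · linarith
        · have hne : A i j ≠ u i + v j := fun h =>
            hj (Finset.mem_biUnion.2 ⟨i, hi, by simpa [N] using h⟩)
          have := hgap (i, j) (sub_pos.2 (lt_of_le_of_ne h0 hne))
          dsimp only at this
          linarith
        · linarith
        · linarith
    have hT' : ((T.biUnion N).card : ℝ) < T.card := by exact_mod_cast hT
    simp only [Finset.sum_sub_distrib, Finset.sum_add_distrib, Finset.sum_ite_mem,
      Finset.univ_inter, Finset.sum_const, nsmul_eq_mul] at this
    nlinarith
  obtain ⟨f, hf, hfN⟩ := (Finset.all_card_le_biUnion_card_iff_exists_injective N).1 hall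
  have hb : Function.Bijective f :=
    (Fintype.bijective_iff_injective_and_card f).2 ⟨hf, Fintype.card_congr e⟩
  exact ⟨Equiv.ofBijective f hb, u, v, huv, fun i => by simpa [N] using hfN i⟩

/-- Strong duality for the assignment problem. -/
theorem exists_assignment_dual {L R : Type*} [Fintype L] [Fintype R] (e : L ≃ R)
    (A : L → R → ℝ) :
    ∃ (σ : L ≃ R) (u : L → ℝ) (v : R → ℝ),
      (∀ i j, A i j ≤ u i + v j) ∧ ∀ i, A i (σ i) = u i + v (σ i) := by
  obtain ⟨C, hC⟩ := (Set.finite_range fun q : L × R => -A q.1 q.2).bddAbove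
  have hC' : ∀ i j, 0 ≤ A i j + C := fun i j => by
    have := hC ⟨(i, j), rfl⟩
    dsimp only at this
    linarith
  obtain ⟨σ, u, v, h1, h2⟩ := exists_assignment_dual_of_nonneg e (fun i j => A i j + C) hC'
  exact ⟨σ, fun i => u i - C, v, fun i j => by linarith [h1 i j], fun i => by linarith [h2 i]⟩

/-- Strong duality for the assignment problem in which only the pairs in `E` may be matched. -/
theorem exists_restricted_assignment_dual {L R : Type*} [Fintype L] [Fintype R]
    (E : L → R → Prop) (A : L → R → ℝ) (e : L ≃ R) (he : ∀ i, E i (e i)) :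
    ∃ (σ : L ≃ R) (u : L → ℝ) (v : R → ℝ), (∀ i, E i (σ i)) ∧
      (∀ i j, E i j → A i j ≤ u i + v j) ∧ ∀ i, A i (σ i) = u i + v (σ i) := by
  classical
  obtain ⟨C, hC⟩ := (Set.finite_range fun q : L × R => |A q.1 q.2|).bddAbove
  have hC' : ∀ i j, |A i j| ≤ C := fun i j => hC ⟨(i, j), rfl⟩
  -- Large enough that an assignment using even one forbidden pair, of weight at most `∑ C - M`, is
  -- worse than `e`, of weight at least `-∑ C`.
  set M : ℝ := 2 * (∑ _i : L, C) + 1 with hM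
  obtain ⟨σ, u, v, h1, h2⟩ := exists_assignment_dual e fun i j => if E i j then A i j else -M
  have hE : ∀ i, E i (σ i) := by
    intro i₀
    by_contra h₀
    have hC0 : 0 ≤ C := (abs_nonneg _).trans (hC' i₀ (e i₀))
    have hM0 : 0 < M := by
      have := Finset.sum_nonneg fun (i : L) (_ : i ∈ Finset.univ) => hC0
      linarith
    have hσ : ∑ i, (if E i (σ i) then A i (σ i) else -M) = ∑ i, u i + ∑ j, v j := by
      rw [← σ.sum_comp v, ← Finset.sum_add_distrib]
      exact Finset.sum_congr rfl fun i _ => h2 i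
    have he' : ∑ i, A i (e i) ≤ ∑ i, u i + ∑ j, v j := by
      rw [← e.sum_comp v, ← Finset.sum_add_distrib]
      exact Finset.sum_le_sum fun i _ => by simpa [he i] using h1 i (e i)
    have hlow : -∑ _i : L, C ≤ ∑ i, A i (e i) := by
      rw [← Finset.sum_neg_distrib]
      exact Finset.sum_le_sum fun i _ => (abs_le.1 (hC' i _)).1
    have hup : ∑ i, (if E i (σ i) then A i (σ i) else -M) ≤
        ∑ i, (C - if i = i₀ then M else 0) := by
      refine Finset.sum_le_sum fun i _ => ?_
      by_cases hi : i = i₀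
      · subst hi
        simp only [h₀, if_true, if_false]
        linarith
      · simp only [hi, if_false, sub_zero]
        split_ifs
        · exact (abs_le.1 (hC' i _)).2
        · linarith
    rw [Finset.sum_sub_distrib, Finset.sum_ite_eq' Finset.univ i₀ fun _ => M] at hup
    simp only [Finset.mem_univ, if_true] at hup
    linarith
  exact ⟨σ, u, v, hE, fun i j hij => by simpa [hij] using h1 i j,
    fun i => by simpa [hE i] using h2 i⟩

/-! ### Integrality and duality for three-layer routing -/

theorem sum_sum_ite_le_one {X Y : Type*} [Fintype X] [Fintype Y] (P : X → Y → Prop)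
    [∀ x y, Decidable (P x y)] (hP : ∀ x y x' y', P x y → P x' y' → x = x' ∧ y = y') :
    ∑ x, ∑ y, (if P x y then 1 else 0) ≤ 1 := by
  rw [← Fintype.sum_prod_type' fun x y => if P x y then 1 else 0, Finset.sum_boole, Nat.cast_id,
    Finset.card_le_one]
  rintro ⟨x, y⟩ h ⟨x', y'⟩ h'
  have := hP x y x' y' (by simpa using h) (by simpa using h')
  simp [this.1, this.2]

theorem eq_of_sum_sum_le_one {X Y : Type*} [Fintype X] [Fintype Y] {f : X → Y → ℕ}
    (hf : ∑ x, ∑ y, f x y ≤ 1) {x x' : X} {y y' : Y} (h : f x y = 1) (h' : f x' y' = 1) :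
    x = x' ∧ y = y' := by
  classical
  rw [← Fintype.sum_prod_type'] at hf
  by_contra hne
  have hne' : (x, y) ≠ (x', y') := fun e => hne (by simpa using e)
  have : ∑ q ∈ {(x, y), (x', y')}, f q.1 q.2 ≤ ∑ q : X × Y, f q.1 q.2 :=
    Finset.sum_le_sum_of_subset (Finset.subset_univ _)
  rw [Finset.sum_pair hne'] at this
  dsimp only at this
  omega

/-- A feasible allocation together with a solution of the dual of the welfare maximization problem
with weights `q` that satisfies complementary slackness. -/
structure IsDualPair {B S D : Type*} [Fintype B] [Fintype S] [Fintype D] (q : B → S → D → ℝ)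
    (x : B → S → D → ℕ) (α : B → ℝ) (β : S → ℝ) (γ : D → ℝ) : Prop where
  feasible : IsFeasible x
  buyer_nonneg : ∀ b, 0 ≤ α b
  store_nonneg : ∀ s, 0 ≤ β s
  courier_nonneg : ∀ d, 0 ≤ γ d
  dual : ∀ b s d, q b s d ≤ α b + β s + γ d
  tight : ∀ b s d, x b s d = 1 → q b s d = α b + β s + γ d
  buyer_slack : ∀ b, (∀ s d, x b s d = 0) → α b = 0
  store_slack : ∀ s, (∀ b d, x b s d = 0) → β s = 0
  courier_slack : ∀ d, (∀ b s, x b s d = 0) → γ d = 0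

/-- The admissible pairs of the assignment problem that encodes routing through three layers:
a store matched to itself is not used, and the other stores are matched to a courier on the left and
to a buyer on the right. -/
def RouteEdge {B S D : Type*} : B ⊕ S ⊕ Option D → Option B ⊕ S ⊕ D → Prop
  | .inl _, .inl _ => True
  | .inl _, .inr (.inl _) => True
  | .inl _, .inr (.inr _) => False
  | .inr (.inl _), .inl _ => False
  | .inr (.inl s), .inr (.inl s') => s = s'
  | .inr (.inl _), .inr (.inr _) => True
  | .inr (.inr _), .inl _ => True
  | .inr (.inr _), .inr (.inl _) => False
  | .inr (.inr _), .inr (.inr _) => True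

/-- The weights of the assignment problem that encodes routing through three layers. -/
def routeWeight {B S D : Type*} (f : B → S → ℝ) (g : S → D → ℝ) :
    B ⊕ S ⊕ Option D → Option B ⊕ S ⊕ D → ℝ
  | .inl b, .inr (.inl s) => f b s
  | .inr (.inl s), .inr (.inr d) => g s d
  | _, _ => 0

/-- The assignment in which no buyer, store or courier is used. -/
def emptyRoute (B S D : Type*) : B ⊕ S ⊕ Option D ≃ Option B ⊕ S ⊕ D where
  toFun
    | .inl b => .inl (some b)
    | .inr (.inl s) => .inr (.inl s)
    | .inr (.inr none) => .inl none
    | .inr (.inr (some d)) => .inr (.inr d)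
  invFun
    | .inl (some b) => .inl b
    | .inl none => .inr (.inr none)
    | .inr (.inl s) => .inr (.inl s)
    | .inr (.inr d) => .inr (.inr (some d))
  left_inv := by rintro (b | s | _ | d) <;> rfl
  right_inv := by rintro ((_ | b) | s | d) <;> rfl

/-- Integrality and strong duality for welfare maximization with weights that split into a
buyer-store part and a store-courier part. -/
theorem exists_isDualPair {B S D : Type*} [Fintype B] [Fintype S] [Fintype D]
    (f : B → S → ℝ) (g : S → D → ℝ) :
    ∃ x α β γ, IsDualPair (fun (b : B) (s : S) (d : D) => f b s + g s d) x α β γ := by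
  classical
  obtain ⟨σ, u, v, hE, hd, ht⟩ := exists_restricted_assignment_dual RouteEdge (routeWeight f g)
    (emptyRoute B S D) (by rintro (b | s | _ | d) <;> simp [RouteEdge, emptyRoute])
  have hinj : ∀ {i i' j}, σ i = j → σ i' = j → i = i' := fun h h' => σ.injective (h.trans h'.symm)
  -- A store chosen by a buyer is no longer available for its own self-match, so it must go on to a
  -- courier; `into` is the converse.
  have out : ∀ b s, σ (.inl b) = .inr (.inl s) → ∃ d, σ (.inr (.inl s)) = .inr (.inr d) := by
    intro b s h
    have hs := hE (.inr (.inl s))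
    rcases hσ : σ (.inr (.inl s)) with o | s' | d
    · simp [hσ, RouteEdge] at hs
    · rw [hσ] at hs
      obtain rfl : s = s' := hs
      cases hinj h hσ
    · exact ⟨d, rfl⟩
  have into : ∀ s d, σ (.inr (.inl s)) = .inr (.inr d) → ∃ b, σ (.inl b) = .inr (.inl s) := by
    intro s d h
    obtain ⟨i, hi⟩ := σ.surjective (.inr (.inl s))
    have hs := hE i
    rw [hi] at hs
    rcases i with b | s' | o
    · exact ⟨b, hi⟩
    · obtain rfl : s' = s := hs
      rw [h] at hi
      simp at hi
    · exact hs.elim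
  -- `Option D` has one element more than `D`, so some idle node on the left meets an idle node on
  -- the right. Their potentials sum to zero and serve as the common reference level for `α` and
  -- `γ`.
  obtain ⟨o, ob, ho⟩ : ∃ (o : Option D) (ob : Option B), σ (.inr (.inr o)) = .inl ob := by
    by_contra! hno
    have : ∀ o : Option D, ∃ d, σ (.inr (.inr o)) = .inr (.inr d) := by
      intro o
      have hs := hE (.inr (.inr o))
      rcases hσ : σ (.inr (.inr o)) with ob | s' | d
      · exact (hno o ob hσ).elim
      · simp [hσ, RouteEdge] at hs
      · exact ⟨d, rfl⟩
    choose k hk using this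
    have hkinj : Function.Injective k := fun o o' h => by
      simpa using hinj (hk o) ((hk o').trans (by rw [h]))
    simpa using Fintype.card_le_of_injective k hkinj
  have hθ : 0 = u (.inr (.inr o)) + v (.inl ob) := by simpa [ho, routeWeight] using ht (.inr (.inr o))
  refine ⟨fun b s d => if σ (.inl b) = .inr (.inl s) ∧ σ (.inr (.inl s)) = .inr (.inr d) then 1 else 0,
    fun b => u (.inl b) + v (.inl ob), fun s => u (.inr (.inl s)) + v (.inr (.inl s)),
    fun d => v (.inr (.inr d)) + u (.inr (.inr o)), ⟨?_, ?_, ?_⟩, ?_, ?_, ?_, ?_, ?_, ?_, ?_, ?_⟩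
  · intro b
    refine sum_sum_ite_le_one _ fun s d s' d' h h' => ?_
    obtain rfl : s = s' := by simpa using h.1.symm.trans h'.1
    exact ⟨rfl, by simpa using h.2.symm.trans h'.2⟩
  · intro s
    refine sum_sum_ite_le_one _ fun b d b' d' h h' => ?_
    exact ⟨by simpa using hinj h.1 h'.1, by simpa using h.2.symm.trans h'.2⟩
  · intro d
    refine sum_sum_ite_le_one _ fun b s b' s' h h' => ?_
    obtain rfl : s = s' := by simpa using hinj h.2 h'.2
    exact ⟨by simpa using hinj h.1 h'.1, rfl⟩
  · exact fun b => hd (.inl b) (.inl ob) trivial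
  · exact fun s => hd (.inr (.inl s)) (.inr (.inl s)) rfl
  · intro d
    have := hd (.inr (.inr o)) (.inr (.inr d)) trivial
    simp only [routeWeight] at this
    linarith
  · intro b s d
    have h1 := hd (.inl b) (.inr (.inl s)) trivial
    have h2 := hd (.inr (.inl s)) (.inr (.inr d)) trivial
    simp only [routeWeight] at h1 h2
    linarith
  · intro b s d h
    have h : σ (.inl b) = .inr (.inl s) ∧ σ (.inr (.inl s)) = .inr (.inr d) := by
      by_contra hn
      simp [hn] at h
    have h1 := ht (.inl b)
    have h2 := ht (.inr (.inl s))
    simp only [h.1, h.2, routeWeight] at h1 h2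
    linarith
  · intro b h
    have h1 := ht (.inl b)
    have hs := hE (.inl b)
    rcases hσ : σ (.inl b) with ob' | s | d
    · have h2 := hd (.inr (.inr o)) (.inl ob') trivial
      have h3 := hd (.inl b) (.inl ob) trivial
      simp only [hσ, routeWeight] at h1 h2 h3
      linarith
    · obtain ⟨d, hsd⟩ := out b s hσ
      simpa [hσ, hsd] using h s d
    · simp [hσ, RouteEdge] at hs
  · intro s h
    have h1 := ht (.inr (.inl s))
    have hs := hE (.inr (.inl s))
    rcases hσ : σ (.inr (.inl s)) with ob' | s' | d
    · simp [hσ, RouteEdge] at hs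
    · rw [hσ] at hs h1
      obtain rfl : s = s' := hs
      exact h1.symm
    · obtain ⟨b, hb⟩ := into s d hσ
      simpa [hσ, hb] using h b d
  · intro d h
    obtain ⟨i, hi⟩ := σ.surjective (.inr (.inr d))
    have h1 := ht i
    have hs := hE i
    rw [hi] at hs h1
    rcases i with b | s | o'
    · exact hs.elim
    · obtain ⟨b, hb⟩ := into s d hi
      simpa [hi, hb] using h b s
    · have h2 := hd (.inr (.inr o')) (.inl ob) trivial
      have h3 := hd (.inr (.inr o)) (.inr (.inr d)) trivial
      simp only [routeWeight] at h1 h2 h3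
      linarith

/-- Optimality does not distinguish buyers from stores; this symmetry transfers the result to costs
with a courier-buyer part. -/
theorem IsDualPair.swap {B S D : Type*} [Fintype B] [Fintype S] [Fintype D] {q : B → S → D → ℝ}
    {x : B → S → D → ℕ} {α : B → ℝ} {β : S → ℝ} {γ : D → ℝ} (h : IsDualPair q x α β γ) :
    IsDualPair (fun s b d => q b s d) (fun s b d => x b s d) β α γ where
  feasible := ⟨h.feasible.supply, h.feasible.demand, fun d => by
    rw [Finset.sum_comm]
    exact h.feasible.capacity d⟩
  buyer_nonneg := h.store_nonneg
  store_nonneg := h.buyer_nonneg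
  courier_nonneg := h.courier_nonneg
  dual s b d := by linarith [h.dual b s d]
  tight s b d hx := by linarith [h.tight b s d hx]
  buyer_slack := h.store_slack
  store_slack := h.buyer_slack
  courier_slack d hd := h.courier_slack d fun b s => hd s b

/-! ### Best responses and feasible allocations -/

theorem some_mem_bestResponse {α R : Type*} [Zero R] [LinearOrder R] {u : α → R} {a : α}
    (h0 : 0 ≤ u a) (h : ∀ a', u a' ≤ u a) : some a ∈ bestResponse u := by
  rcases h0.eq_or_lt with h0 | h0
  · exact Or.inr ⟨fun ⟨a', ha'⟩ => (ha'.trans_le (h a')).ne h0, Or.inr ⟨a, rfl, h0.symm⟩⟩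
  · exact Or.inl ⟨⟨a, h0⟩, a, rfl, h⟩

theorem none_mem_bestResponse {α R : Type*} [Zero R] [LinearOrder R] {u : α → R}
    (h : ∀ a, u a ≤ 0) : none ∈ bestResponse u :=
  Or.inr ⟨fun ⟨a, ha⟩ => (h a).not_gt ha, Or.inl rfl⟩

theorem le_of_some_mem_bestResponse {α R : Type*} [Zero R] [LinearOrder R] {u : α → R} {a : α}
    (h : some a ∈ bestResponse u) : 0 ≤ u a ∧ ∀ a', u a' ≤ u a := by
  rcases h with ⟨⟨a₁, h₁⟩, a₂, h₂, h₃⟩ | ⟨h₁, h₂ | ⟨a₂, h₂, h₃⟩⟩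
  · cases h₂
    exact ⟨h₁.le.trans (h₃ a₁), h₃⟩
  · cases h₂
  · cases h₂
    exact ⟨h₃.ge, fun a' => h₃.symm ▸ not_lt.1 fun h => h₁ ⟨a', h⟩⟩

theorem le_zero_of_none_mem_bestResponse {α R : Type*} [Zero R] [LinearOrder R] {u : α → R}
    (h : none ∈ bestResponse u) (a : α) : u a ≤ 0 := by
  rcases h with ⟨_, _, h, _⟩ | ⟨h, _⟩
  · cases h
  · exact not_lt.1 fun h' => h ⟨a, h'⟩

namespace IsFeasible

variable {B S D : Type*} [Fintype B] [Fintype S] [Fintype D] {x : B → S → D → ℕ}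

theorem eq_zero_or_eq_one (h : IsFeasible x) (b : B) (s : S) (d : D) :
    x b s d = 0 ∨ x b s d = 1 := by
  have h1 : ∑ d, x b s d ≤ ∑ s, ∑ d, x b s d :=
    Finset.single_le_sum (f := fun s => ∑ d, x b s d) (fun _ _ => Nat.zero_le _) (Finset.mem_univ s)
  have h2 : x b s d ≤ ∑ d, x b s d :=
    Finset.single_le_sum (f := fun d => x b s d) (fun _ _ => Nat.zero_le _) (Finset.mem_univ d)
  have := h.demand b
  omega

end IsFeasible

theorem exists_isStoreOf {B S D : Type*} [Fintype B] [Fintype S] [Fintype D]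
    {x : B → S → D → ℕ} (h : IsFeasible x) (b : B) : ∃ o, IsStoreOf x b o := by
  by_cases h0 : ∀ s d, x b s d = 0
  · exact ⟨none, h0⟩
  · push Not at h0
    obtain ⟨s, d, hsd⟩ := h0
    exact ⟨some s, d, (h.eq_zero_or_eq_one b s d).resolve_left hsd⟩

/-- Collects the dual values agent by agent. Each multiplicity is at most one by feasibility, and
zero multiplicities are where slackness applies. -/
theorem sum_mul_add_add {B S D : Type*} [Fintype B] [Fintype S] [Fintype D]
    (x : B → S → D → ℕ) (α : B → ℝ) (β : S → ℝ) (γ : D → ℝ) :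
    ∑ b, ∑ s, ∑ d, (x b s d : ℝ) * (α b + β s + γ d) =
      ∑ b, α b * ((∑ s, ∑ d, x b s d : ℕ) : ℝ) + ∑ s, β s * ((∑ b, ∑ d, x b s d : ℕ) : ℝ) +
        ∑ d, γ d * ((∑ b, ∑ s, x b s d : ℕ) : ℝ) := by
  have h1 : ∑ s, β s * ((∑ b, ∑ d, x b s d : ℕ) : ℝ) = ∑ b, ∑ s, ∑ d, (x b s d : ℝ) * β s := by
    rw [Finset.sum_comm]
    simp only [Nat.cast_sum, Finset.mul_sum, mul_comm]
  have h2 : ∑ d, γ d * ((∑ b, ∑ s, x b s d : ℕ) : ℝ) = ∑ b, ∑ s, ∑ d, (x b s d : ℝ) * γ d := by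
    simp only [Nat.cast_sum, Finset.mul_sum]
    rw [Finset.sum_comm]
    refine Finset.sum_congr rfl fun b _ => ?_
    rw [Finset.sum_comm]
    simp only [mul_comm]
  rw [h1, h2]
  simp only [Nat.cast_sum, Finset.mul_sum, ← Finset.sum_add_distrib]
  exact Finset.sum_congr rfl fun b _ => Finset.sum_congr rfl fun s _ =>
    Finset.sum_congr rfl fun d _ => by ring

/-! ### Optimality of dual pairs and their with-tip equilibria -/

namespace IsDualPair

variable {B S D : Type*} [Fintype B] [Fintype S] [Fintype D] {M : Market B S D}
  {x : B → S → D → ℕ} {α : B → ℝ} {β : S → ℝ} {γ : D → ℝ}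

/-- Weak duality bounds every feasible welfare by the sum of all dual values, and complementary
slackness makes `x` attain it. -/
theorem isOptimalWelfare (h : IsDualPair (fun b s d => M.v b s - M.c d b s) x α β γ) :
    M.IsOptimalWelfare (M.welfare x) := by
  refine ⟨⟨x, h.feasible, rfl⟩, ?_⟩
  rintro _ ⟨y, hy, rfl⟩
  have hub : ∀ {n : ℕ} {r : ℝ}, 0 ≤ r → n ≤ 1 → r * n ≤ r := fun hr hn =>
    mul_le_of_le_one_right hr (by exact_mod_cast hn)
  calc M.welfare y
      ≤ ∑ b, ∑ s, ∑ d, (y b s d : ℝ) * (α b + β s + γ d) := by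
        refine Finset.sum_le_sum fun b _ => Finset.sum_le_sum fun s _ =>
          Finset.sum_le_sum fun d _ => ?_
        exact mul_le_mul_of_nonneg_left (h.dual b s d) (Nat.cast_nonneg _)
    _ ≤ ∑ b, α b + ∑ s, β s + ∑ d, γ d := by
        rw [sum_mul_add_add]
        refine add_le_add (add_le_add ?_ ?_) ?_
        · exact Finset.sum_le_sum fun b _ => hub (h.buyer_nonneg b) (hy.demand b)
        · exact Finset.sum_le_sum fun s _ => hub (h.store_nonneg s) (hy.supply s)
        · exact Finset.sum_le_sum fun d _ => hub (h.courier_nonneg d) (hy.capacity d)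
    _ = ∑ b, ∑ s, ∑ d, (x b s d : ℝ) * (α b + β s + γ d) := by
        have hcs : ∀ {n : ℕ} {r : ℝ}, n ≤ 1 → (n = 0 → r = 0) → r = r * n := by
          intro n r hn h0
          interval_cases n <;> simp_all
        rw [sum_mul_add_add]
        refine congrArg₂ _ (congrArg₂ _ ?_ ?_) ?_
        · exact Finset.sum_congr rfl fun b _ => hcs (h.feasible.demand b) fun h0 =>
            h.buyer_slack b (by simpa using h0)
        · exact Finset.sum_congr rfl fun s _ => hcs (h.feasible.supply s) fun h0 =>
            h.store_slack s (by simpa using h0)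
        · exact Finset.sum_congr rfl fun d _ => hcs (h.feasible.capacity d) fun h0 =>
            h.courier_slack d (by simpa using h0)
    _ = M.welfare x := by
        refine Finset.sum_congr rfl fun b _ => Finset.sum_congr rfl fun s _ =>
          Finset.sum_congr rfl fun d _ => ?_
        rcases h.feasible.eq_zero_or_eq_one b s d with hx | hx
        · simp [hx]
        · rw [← h.tight b s d hx]

/-- A dual pair is supported by a with-tip equilibrium in which no tip is paid: the platform
compensates the couriers in full, and the store prices make up for it. -/
theorem exists_isWithTipEquilibrium
    (h : IsDualPair (fun b s d => M.v b s - M.c d b s) x α β γ) :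
    ∃ (p : S → ℝ) (w t : B → S → ℝ), M.IsWithTipEquilibrium p w t x := by
  set w : B → S → ℝ := fun b s => ∑ d, (x b s d : ℝ) * (γ d + M.c d b s) with hw
  have hγc : ∀ d b s, 0 ≤ γ d + M.c d b s := fun d b s =>
    add_nonneg (h.courier_nonneg d) (M.c_nonneg d b s)
  have hw0 : ∀ b s, 0 ≤ w b s := fun b s =>
    Finset.sum_nonneg fun d _ => mul_nonneg (Nat.cast_nonneg _) (hγc d b s)
  have hwz : ∀ b s, (∀ d, x b s d = 0) → w b s = 0 := fun b s h0 => by simp [hw, h0]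
  have hx0 : ∀ {b s d}, x b s d ≠ 1 → x b s d = 0 := fun h1 =>
    (h.feasible.eq_zero_or_eq_one _ _ _).resolve_right h1
  have hw1 : ∀ {b s d}, x b s d = 1 → w b s = γ d + M.c d b s := by
    intro b s d h1
    have : w b s = (x b s d : ℝ) * (γ d + M.c d b s) := by
      refine Finset.sum_eq_single d (fun d' _ hd' => ?_) (by simp)
      rw [hx0 fun h2 => hd' (eq_of_sum_sum_le_one (h.feasible.demand b) h2 h1).2]
      simp
    simpa [h1] using this
  -- At most one summand `w b s` is nonzero, the one of the order sold by `s`; an unsold store is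
  -- left with `β s = 0`.
  set p : S → ℝ := fun s => β s + ∑ b, w b s with hp
  have hp1 : ∀ {b s d}, x b s d = 1 → p s = M.v b s - α b := by
    intro b s d h1
    have : ∑ b', w b' s = w b s := by
      refine Finset.sum_eq_single b (fun b' _ hb' => hwz b' s fun d' => hx0 fun h2 => ?_) (by simp)
      exact hb' (eq_of_sum_sum_le_one (h.feasible.supply s) h2 h1).1
    have h2 := h.tight b s d h1
    simp only [hp, this, hw1 h1]
    linarith
  have hpβ : ∀ s, β s ≤ p s := fun s =>
    le_add_of_nonneg_right (Finset.sum_nonneg fun b _ => hw0 b s)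
  -- On an order delivered by `d'`, the tight equation for `d'` minus the dual inequality for `d`
  -- gives the bound.
  have hcour : ∀ d b s, w b s - M.c d b s ≤ γ d := by
    intro d b s
    by_cases h0 : ∀ d, x b s d = 0
    · rw [hwz b s h0]
      linarith [hγc d b s]
    · push Not at h0
      obtain ⟨d', hd'⟩ := h0
      have h1 := (h.feasible.eq_zero_or_eq_one b s d').resolve_left hd'
      have h2 := h.tight b s d' h1
      have h3 := h.dual b s d
      rw [hw1 h1]
      linarith
  have hBR : ∀ d o, IsOrderOf x d o → o ∈ M.courierBR w 0 d := by
    rintro d (_ | ⟨b, s⟩) ho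
    · refine none_mem_bestResponse fun a => ?_
      have := hcour d a.1 a.2
      rw [h.courier_slack d ho] at this
      simpa using this
    · have hval : w b s - M.c d b s = γ d := by
        rw [hw1 ho]
        ring
      refine some_mem_bestResponse ?_ fun a => ?_
      · simpa [hval] using h.courier_nonneg d
      · simpa [hval] using hcour d a.1 a.2
  have htip0 : ∀ b s, 0 ≤ M.minTip w 0 b s := by
    refine fun b s => le_sInf ?_
    rintro r ⟨t', ht', -, -, rfl⟩
    exact_mod_cast ht' b s
  have htip : ∀ {b s d}, x b s d = 1 → M.minTip w 0 b s = 0 := fun {b s d} h1 =>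
    le_antisymm (sInf_le ⟨0, fun _ _ => le_rfl, fun _ _ => rfl, ⟨d, hBR d (some (b, s)) h1⟩, rfl⟩)
      (htip0 b s)
  have hbuy : ∀ b s, ((M.v b s - p s : ℝ) : EReal) - M.minTip w 0 b s ≤ (α b : ℝ) := by
    intro b s
    by_cases h0 : ∀ d, x b s d = 0
    · rw [EReal.sub_le_iff_le_add (Or.inr (EReal.coe_ne_top _)) (Or.inr (EReal.coe_ne_bot _)),
        add_comm, ← EReal.sub_le_iff_le_add (Or.inl (EReal.coe_ne_bot _))
          (Or.inl (EReal.coe_ne_top _))]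
      -- It suffices to bound every admissible tip from below; without couriers there is none and
      -- the minimum tip is `⊤`.
      refine le_sInf ?_
      rintro r ⟨t', ht', -, ⟨d, hd⟩, rfl⟩
      obtain ⟨hd0, hd1⟩ := le_of_some_mem_bestResponse hd
      -- Courier `d` gives up at least `γ d` by leaving the order assigned in `x`, since the tips in
      -- `t'` can only make that order more attractive.
      have hγ : γ d ≤ w b s - M.c d b s + t' b s := by
        by_cases hx : ∀ b s, x b s d = 0
        · simpa [h.courier_slack d hx] using hd0
        · push Not at hx
          obtain ⟨b', s', hx'⟩ := hx
          have hx1 := (h.feasible.eq_zero_or_eq_one b' s' d).resolve_left hx'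
          have h1 := hd1 (b', s')
          have h2 := hw1 hx1
          have h3 := ht' b' s'
          dsimp only at h1
          linarith
      rw [hwz b s h0] at hγ
      have h1 := h.dual b s d
      have h2 := hpβ s
      rw [← EReal.coe_sub]
      exact_mod_cast (by linarith : M.v b s - p s - α b ≤ t' b s)
    · push Not at h0
      obtain ⟨d', hd'⟩ := h0
      have h1 := (h.feasible.eq_zero_or_eq_one b s d').resolve_left hd'
      rw [htip h1, hp1 h1]
      simp
  refine ⟨p, w, 0, fun s => (h.store_nonneg s).trans (hpβ s), hw0, fun _ _ => le_rfl, h.feasible,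
    ?_, ?_, hBR, ?_, ?_⟩
  · rintro b (_ | s) ho
    · refine none_mem_bestResponse fun s => ?_
      simpa [h.buyer_slack b ho] using hbuy b s
    · obtain ⟨d, hd⟩ := ho
      have hval : ((M.v b s - p s : ℝ) : EReal) - M.minTip w 0 b s = (α b : ℝ) := by
        rw [htip hd, hp1 hd]
        simp
      refine some_mem_bestResponse ?_ fun s' => ?_
      · rw [hval]
        exact_mod_cast h.buyer_nonneg b
      · rw [hval]
        exact hbuy b s'
  · rintro b s ⟨d, hd⟩
    simp [htip hd]
  · intro s hs
    have hs' : ∀ b d, x b s d = 0 := by simpa using hs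
    simp [hp, h.store_slack s hs', hwz _ s (hs' _)]
  · intro b s hs
    exact ⟨hwz b s (by simpa using hs), rfl⟩

end IsDualPair

theorem Market.exists_isDualPair {B S D : Type*} [Fintype B] [Fintype S] [Fintype D]
    (M : Market B S D) (hM : M.HasStoreDecomposition ∨ M.HasBuyerDecomposition) :
    ∃ x α β γ, IsDualPair (fun b s d => M.v b s - M.c d b s) x α β γ := by
  rcases hM with ⟨c, e, hc⟩ | ⟨c, e, hc⟩
  · obtain ⟨x, α, β, γ, h⟩ := _root_.exists_isDualPair (fun b s => M.v b s - c b s) fun s d => -e d s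
    refine ⟨x, α, β, γ, ?_⟩
    convert h using 4 with b s d
    rw [hc]
    ring
  · obtain ⟨x, α, β, γ, h⟩ := _root_.exists_isDualPair (fun s b => M.v b s - c b s) fun b d => -e d b
    refine ⟨fun b s d => x s b d, β, α, γ, ?_⟩
    convert h.swap using 4 with b s d
    rw [hc]
    ring

/-! ### A market with arbitrarily bad without-tip equilibria -/

/-- A buyer chooses between a store of value `2` with delivery cost `C` and a store of value `1`
with free delivery. -/
def costlyDeliveryMarket (C : ℝ) (hC : 0 ≤ C) : Market (Fin 1) (Fin 2) (Fin 1) where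
  v _ s := if s = 0 then 2 else 1
  c _ _ s := if s = 0 then C else 0
  v_nonneg _ s := by split_ifs <;> norm_num
  c_nonneg _ _ s := by split_ifs <;> simp [hC]

namespace costlyDeliveryMarket

variable {C : ℝ} {hC : 0 ≤ C}

theorem welfare_eq (x : Fin 1 → Fin 2 → Fin 1 → ℕ) :
    (costlyDeliveryMarket C hC).welfare x = x 0 0 0 * (2 - C) + x 0 1 0 := by
  simp [Market.welfare, costlyDeliveryMarket, Fin.sum_univ_two]

theorem isOptimalWelfare (h1 : 1 ≤ C) : (costlyDeliveryMarket C hC).IsOptimalWelfare 1 := by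
  refine ⟨⟨fun _ s _ => if s = 0 then 0 else 1, ⟨?_, ?_, ?_⟩, ?_⟩, ?_⟩
  · intro b
    simp [Fin.sum_univ_two]
  · intro s
    fin_cases s <;> simp
  · intro d
    simp [Fin.sum_univ_two]
  · simp [welfare_eq]
  · rintro _ ⟨y, hy, rfl⟩
    have h := hy.demand 0
    simp only [Fin.sum_univ_two, Finset.univ_unique, Finset.sum_singleton] at h
    have h : (y 0 0 0 : ℝ) + y 0 1 0 ≤ 1 := by exact_mod_cast h
    have h0 : (0 : ℝ) ≤ y 0 0 0 := Nat.cast_nonneg _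
    rw [welfare_eq]
    nlinarith

/-- The compensation `C` leaves the courier indifferent and is charged to neither the buyer nor the
store. -/
theorem isWithoutTipEquilibrium :
    (costlyDeliveryMarket C hC).IsWithoutTipEquilibrium 0 (fun _ s => if s = 0 then C else 0)
      (fun _ s _ => if s = 0 then 1 else 0) where
  price_nonneg _ := le_rfl
  comp_nonneg _ s := by split_ifs <;> simp [hC]
  feasible := by
    refine ⟨fun b => ?_, fun s => ?_, fun d => ?_⟩
    · simp
    · fin_cases s <;> simp
    · simp
  buyer := by
    rintro b (_ | s) ho
    · simpa using ho 0 0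
    · obtain ⟨d, hd⟩ := ho
      have hs : s = 0 := by simpa using hd
      subst hs
      refine some_mem_bestResponse ?_ fun s => ?_
      · simp [costlyDeliveryMarket]
      · fin_cases s <;> simp [costlyDeliveryMarket]
  courier := by
    rintro d (_ | ⟨b, s⟩) ho
    · simpa using ho 0 0
    · refine some_mem_bestResponse ?_ fun a => ?_ <;> simp [costlyDeliveryMarket]
  unsold _ _ := rfl
  undelivered b s hs := by
    by_contra hne
    have : s = 0 := by
      by_contra h
      simp [h] at hne
    simp [this] at hs

/-- If store `0` were unsold, its price would be zero and the buyer would get 2 there, more than the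
other store or the null option can offer. -/
theorem welfare_of_isWithoutTipEquilibrium {p w x}
    (h : (costlyDeliveryMarket C hC).IsWithoutTipEquilibrium p w x) :
    (costlyDeliveryMarket C hC).welfare x = 2 - C := by
  have hd := h.feasible.demand 0
  simp only [Fin.sum_univ_two, Finset.univ_unique, Finset.sum_singleton, Fin.default_eq_zero] at hd
  have hx : x 0 0 0 = 1 := by
    by_contra hne
    have h0 : x 0 0 0 = 0 := by omega
    have hp : p 0 = 0 := h.unsold 0 (by simpa using h0)
    obtain ⟨o, ho⟩ := exists_isStoreOf h.feasible 0
    have hbr := h.buyer 0 o ho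
    rcases o with _ | s
    · have := le_zero_of_none_mem_bestResponse hbr 0
      norm_num [costlyDeliveryMarket, hp] at this
    · have hs : s = 1 := by
        obtain ⟨d, hd⟩ := ho
        fin_cases s
        · rw [Subsingleton.elim d 0] at hd
          exact absurd hd hne
        · rfl
      subst hs
      have := (le_of_some_mem_bestResponse hbr).2 0
      have hp1 := h.price_nonneg 1
      norm_num [costlyDeliveryMarket, hp] at this
      linarith
  have hx' : x 0 1 0 = 0 := by omega
  simp [welfare_eq, hx, hx']

end costlyDeliveryMarket

theorem mainTheorem2 :
    (∀ {B S D : Type*} [Fintype B] [Fintype S] [Fintype D] (M : Market B S D),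
      M.HasStoreDecomposition ∨ M.HasBuyerDecomposition →
      ∃ (p : S → ℝ) (w t : B → S → ℝ) (x : B → S → D → ℕ),
        M.IsWithTipEquilibrium p w t x ∧ M.IsOptimalWelfare (M.welfare x)) ∧
    (∀ K : ℝ, ∃ (m n l : ℕ) (M : Market (Fin m) (Fin n) (Fin l)),
      M.HasStoreDecomposition ∧ M.HasBuyerDecomposition ∧ M.IsOptimalWelfare 1 ∧
      (∃ p w x, M.IsWithoutTipEquilibrium p w x) ∧
      ∀ p w x, M.IsWithoutTipEquilibrium p w x → M.welfare x < K) := by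
  refine ⟨fun M hM => ?_, fun K => ?_⟩
  · obtain ⟨x, α, β, γ, h⟩ := M.exists_isDualPair hM
    obtain ⟨p, w, t, he⟩ := h.exists_isWithTipEquilibrium
    exact ⟨p, w, t, x, he, h.isOptimalWelfare⟩
  -- With `C = 3 + |K|` the equilibrium welfare `2 - C = -1 - |K|` is below `K`. With a single
  -- courier the whole cost can be put into the buyer-store part.
  · have hC : 0 ≤ 3 + |K| := by positivity
    refine ⟨1, 2, 1, costlyDeliveryMarket (3 + |K|) hC, ?_, ?_, ?_,
      ⟨_, _, _, costlyDeliveryMarket.isWithoutTipEquilibrium⟩, fun p w x h => ?_⟩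
    · exact ⟨(costlyDeliveryMarket (3 + |K|) hC).c 0, 0, fun d b s => by
        rw [Subsingleton.elim d 0]
        simp⟩
    · exact ⟨(costlyDeliveryMarket (3 + |K|) hC).c 0, 0, fun d b s => by
        rw [Subsingleton.elim d 0]
        simp⟩
    · exact costlyDeliveryMarket.isOptimalWelfare (by linarith [abs_nonneg K])
    · rw [costlyDeliveryMarket.welfare_of_isWithoutTipEquilibrium h]
      linarith [neg_abs_le K]
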